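/- Let $H$ be a (real or complex) Hilbert space and let $\Theta\subseteq\mathbb{R}^d$ be Lebesgue measurable. For every $\theta\in\Theta$ let $H_\theta\subseteq H$ be a closed subspace with canonical embedding $\iota_\theta\colon H_\theta\hookrightarrow H$, let $M(\theta)\in L(H_\theta)$, and let $A(\theta)\colon\operatorname{dom}(A(\theta))\subseteq H_\theta\to H_\theta$ be densely defined and linear. Assume that $\sup_{\theta\in\Theta}\|M(\theta)\|<\infty$, that $A(\theta)=-A(\theta)^*$ for all $\theta$, and that there is $c>0$ with $\operatorname{Re}M(\theta)=\tfrac12(M(\theta)+M(\theta)^*)\ge c$ for all $\theta\in\Theta$. Assume further that for every $\theta\in\Theta$ there is given a closed subspace $N(\theta)\subseteq H_\theta$ such that, with $R(\theta):=N(\theta)^\perp$ (the complement in $H_\theta$), $\iota_{R(\theta)}\colon R(\theta)\hookrightarrow H_\theta$ the embedding, and $\pi_{N(\theta)},\pi_{R(\theta)}$ the orthogonal projections of $H_\theta$ onto $N(\theta)$ and $R(\theta)$: (a) $A(\theta)\pi_{N(\theta)}$ is bounded for all $\theta\in\Theta$; (b) $\pi_{R(\theta)}A(\theta)\subseteq A(\theta)\pi_{R(\theta)}$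 for all $\theta\in\Theta$; (c) $\iota_{R(\theta)}^*A(\theta)\iota_{R(\theta)}$ is boundedly invertible for all $\theta\in\Theta$, and $\sup_{\theta\in\Theta}\big\|\big(\iota_{R(\theta)}^*A(\theta)\iota_{R(\theta)}\big)^{-1}\big\|<\infty$. For $\varepsilon>0$ put $$S_\varepsilon(\theta):=\iota_\theta\big(M(\theta)+\tfrac1\varepsilon A(\theta)\big)^{-1}\iota_\theta^*,\qquad T_\varepsilon(\theta):=\iota_\theta\big(\pi_{N(\theta)}M(\theta)\pi_{N(\theta)}+\tfrac1\varepsilon A(\theta)\big)^{-1}\iota_\theta^*,$$ and assume that $S_\varepsilon$ is weakly measurable, i.e. $\theta\mapsto\langle x,S_\varepsilon(\theta)y\rangle$ is measurable for all $x,y\in H$ and all $\varepsilon>0$. For a family $T(\theta)\in L(H)$, $\theta\in\Theta$, the direct integral $\int_\Theta^\oplus T(\theta)\,d\theta$ is the bounded operator on $\int_\Theta^\oplus H\,d\theta=L^2(\Theta;H)$ given by $f\mapsto\big(\theta\mapsto T(\theta)f(\theta)\big)$, if this is well defined. Then for all $\varepsilon>0$ and $\theta\in\Theta$ the operators $M(\theta)+\tfrac1\varepsilon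 A(\theta)$ and $\pi_{N(\theta)}M(\theta)\pi_{N(\theta)}+\tfrac1\varepsilon A(\theta)$ are boundedly invertible; if $H$ is separable, then the direct integral of $S_\varepsilon$ exists for all $\varepsilon>0$, and that of $T_\varepsilon$ exists for every $\varepsilon>0$ for which $T_\varepsilon$ is weakly measurable. Moreover, there exists $\kappa>0$ such that for all $\varepsilon>0$ for which both direct integrals exist, $$\Big\|\int_\Theta^\oplus S_\varepsilon(\theta)\,d\theta-\int_\Theta^\oplus T_\varepsilon(\theta)\,d\theta\Big\|\le\kappa\,\varepsilon .$$ -/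

import Mathlib

open MeasureTheory

namespace FibreHom

noncomputable section

section UnboundedOperators

variable {𝕜 : Type*} [RCLike 𝕜]
variable {E F G : Type*} [NormedAddCommGroup E] [InnerProductSpace 𝕜 E]
  [NormedAddCommGroup F] [InnerProductSpace 𝕜 F] [NormedAddCommGroup G] [InnerProductSpace 𝕜 G]

/-- The composition `A B` of a partially defined operator `A` with an everywhere defined bounded
operator `B`, on its natural domain `{x | B x ∈ dom A}`. -/
def compCLM (A : F →ₗ.[𝕜] G) (B : E →L[𝕜] F) : E →ₗ.[𝕜] G where
  domain := A.domain.comap (B : E →ₗ[𝕜] F)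
  toFun := A.toFun ∘ₗ
    ((B : E →ₗ[𝕜] F).restrict (p := A.domain.comap (B : E →ₗ[𝕜] F)) (q := A.domain) fun _ h => h)

/-- A partially defined operator is bounded if `‖T x‖ ≤ K ‖x‖` on its domain, for some `K`. -/
def IsBoundedOp (T : E →ₗ.[𝕜] F) : Prop :=
  ∃ K : ℝ, ∀ x : T.domain, ‖T x‖ ≤ K * ‖(x : E)‖

/-- The everywhere defined bounded operator `S` is the two-sided inverse of `T`. -/
def IsInverseOf (S : F →L[𝕜] E) (T : E →ₗ.[𝕜] F) : Prop :=
  (∀ x : T.domain, S (T x) = x) ∧ ∀ y : F, ∃ h : S y ∈ T.domain, T ⟨S y, h⟩ = y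

/-- `T` is a bijection from its domain onto `F`, with bounded inverse. -/
def BoundedlyInvertible (T : E →ₗ.[𝕜] F) : Prop :=
  ∃ S : F →L[𝕜] E, IsInverseOf S T

open scoped Classical in
/-- The bounded inverse `T⁻¹`; only meaningful (and then unique) if `T` is boundedly invertible. -/
def boundedInverse (T : E →ₗ.[𝕜] F) : F →L[𝕜] E :=
  if h : BoundedlyInvertible T then h.choose else 0

theorem boundedInverse_eq {T : E →ₗ.[𝕜] F} {S : F →L[𝕜] E} (h : IsInverseOf S T) :
    boundedInverse T = S := by
  have hT : BoundedlyInvertible T := ⟨S, h⟩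
  have h' : IsInverseOf (boundedInverse T) T := by
    rw [boundedInverse, dif_pos hT]
    exact hT.choose_spec
  ext y
  obtain ⟨hy, e⟩ := h.2 y
  have := h'.1 ⟨S y, hy⟩
  rwa [e] at this

/-- `A = -A*`, for a densely defined operator `A`. -/
def IsSkewSelfAdjoint [CompleteSpace E] (A : E →ₗ.[𝕜] E) : Prop :=
  Dense (A.domain : Set E) ∧ A = -A.adjoint

/-- `Re M = (M + M*) / 2`. -/
def rePart [CompleteSpace E] (M : E →L[𝕜] E) : E →L[𝕜] E :=
  (2⁻¹ : 𝕜) • (M + ContinuousLinearMap.adjoint M)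

/-- The operator `M + ε⁻¹ A`, with domain `dom A`. -/
def pencil (M : E →L[𝕜] E) (A : E →ₗ.[𝕜] E) (ε : ℝ) : E →ₗ.[𝕜] E :=
  (M : E →ₗ[𝕜] E) +ᵥ ((ε⁻¹ : ℝ) : 𝕜) • A

/-- The compression `ι_K* A ι_K` of `A` to a closed subspace `K`, with domain `K ∩ dom A`. -/
def compression [CompleteSpace E] (A : E →ₗ.[𝕜] E) (K : Submodule 𝕜 E) [CompleteSpace K] :
    K →ₗ.[𝕜] K :=
  (ContinuousLinearMap.adjoint K.subtypeL : E →ₗ[𝕜] K).compPMap (compCLM A K.subtypeL)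

/-- The operator `π_N M π_N`. -/
def cornerOp (M : E →L[𝕜] E) (N : Submodule 𝕜 E) [N.HasOrthogonalProjection] : E →L[𝕜] E :=
  N.starProjection ∘L M ∘L N.starProjection

/-- `ι_K T ι_K*`, the extension by zero of an operator `T` on a closed subspace `K`. -/
def extendByZero [CompleteSpace E] (K : Submodule 𝕜 E) [CompleteSpace K] (T : K →L[𝕜] K) :
    E →L[𝕜] E :=
  K.subtypeL ∘L T ∘L ContinuousLinearMap.adjoint K.subtypeL

end UnboundedOperators

section DirectIntegrals

variable {𝕜 : Type*} [RCLike 𝕜] {H : Type*} [NormedAddCommGroup H] [InnerProductSpace 𝕜 H]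
variable {X : Type*} [MeasurableSpace X]

/-- Lebesgue measure on a subset `Θ` of `ℝ^d`, as a measure on the type of points of `Θ`. -/
def lebesgueOn {d : ℕ} (Θ : Set (EuclideanSpace ℝ (Fin d))) : Measure Θ :=
  Measure.comap Subtype.val volume

/-- All matrix coefficients `θ ↦ ⟪x, T(θ) y⟫` are measurable (with respect to the completion
of `μ`). -/
def WeaklyMeasurable (μ : Measure X) (T : X → H →L[𝕜] H) : Prop :=
  ∀ x y : H, AEMeasurable (fun θ => inner 𝕜 x (T θ y)) μ

/-- `C = ∫^⊕ T(θ) dμ(θ)` on `∫^⊕ H dμ = L²(X, μ; H)`: `C` acts fibrewise,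
`(C f)(θ) = T(θ) f(θ)` for almost every `θ`. -/
def IsDirectIntegral (μ : Measure X) (T : X → H →L[𝕜] H) (C : Lp H 2 μ →L[𝕜] Lp H 2 μ) : Prop :=
  ∀ f : Lp H 2 μ, (C f : X → H) =ᵐ[μ] fun θ => T θ (f θ)

/-- The family `θ ↦ ι_θ (M(θ) + ε⁻¹ A(θ))⁻¹ ι_θ*` of operators on `H`, where `ι_θ` is the
embedding of the closed subspace `E θ` into `H`. -/
def fibreInverse {Θ : Type*} [CompleteSpace H] (E : Θ → Submodule 𝕜 H) [∀ θ, CompleteSpace (E θ)]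
    (M : ∀ θ, E θ →L[𝕜] E θ) (A : ∀ θ, E θ →ₗ.[𝕜] E θ) (ε : ℝ) (θ : Θ) : H →L[𝕜] H :=
  extendByZero (E θ) (boundedInverse (pencil (M θ) (A θ) ε))

end DirectIntegrals

/-- A family of operators `A(θ)` in Hilbert spaces `E θ` and closed subspaces `N(θ)`, with
`R(θ) = N(θ)ᗮ`, such that `A(θ) π_N` is bounded, `π_R A(θ) ⊆ A(θ) π_R`, and `ι_R* A(θ) ι_R` is
boundedly invertible, uniformly in `θ`. -/
structure FibreHypothesis {𝕜 : Type*} [RCLike 𝕜] {X : Type*} {E : X → Type*}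
    [∀ θ, NormedAddCommGroup (E θ)] [∀ θ, InnerProductSpace 𝕜 (E θ)] [∀ θ, CompleteSpace (E θ)]
    (A : ∀ θ, E θ →ₗ.[𝕜] E θ) (N : ∀ θ, Submodule 𝕜 (E θ)) [∀ θ, CompleteSpace (N θ)] :
    Prop where
  bounded : ∀ θ, IsBoundedOp (compCLM (A θ) (N θ).starProjection)
  reduces : ∀ θ, ((N θ)ᗮ.starProjection : E θ →ₗ[𝕜] E θ).compPMap (A θ) ≤
    compCLM (A θ) (N θ)ᗮ.starProjection
  invertible : ∀ θ, BoundedlyInvertible (compression (A θ) (N θ)ᗮ)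
  uniform : BddAbove (Set.range fun θ => ‖boundedInverse (compression (A θ) (N θ)ᗮ)‖)

end

end FibreHom

namespace FibreHom

/-! ### Coercive perturbations of skew-selfadjoint operators -/

section Fibre

variable {𝕜 : Type*} [RCLike 𝕜] {E : Type*} [NormedAddCommGroup E] [InnerProductSpace 𝕜 E]

/-! The estimate is fibrewise. Write `P`, `Q` for the projections onto `N` and `Nᗮ`; by hypothesis
they commute with `A`. As `Re ⟪A x, x⟫ = 0`, the pencil inherits the coercivity of `M`, so it is
invertible with inverse bounded by `c⁻¹`, whatever `ε` is.

Let `u`, `v` solve the full and the corner equation for the same `y`. On `Nᗮ` the equation for `u`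
reads `A Q u = ε Q (y - M u)`, and that for `v` reads `A Q v = ε Q y`; the bounded inverse of `A`
there makes `Q u` and `Q v` of order `ε`. On `N`, the difference `w = P u - P v` solves `(P M P +
ε⁻¹ A) w = -P M Q u`, and coercivity of `P M P` on `N` makes `w` of order `ε` too
(`norm_boundedInverse_pencil_sub_le`). The constants depend only on `c`, `sup ‖M‖` and the uniform
bound of the inverses on `Nᗮ`.

A fibrewise operator bound passes to the direct integrals (`IsDirectIntegral.norm_sub_le`); these
exist for weakly measurable bounded families when `H` is separable. -/

theorem IsInverseOf.of_injective {F : Type*} [NormedAddCommGroup F] [InnerProductSpace 𝕜 F]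
    {S : F →L[𝕜] E} {T : E →ₗ.[𝕜] F}
    (hT : ∀ x : T.domain, T x = 0 → (x : E) = 0)
    (hS : ∀ y : F, ∃ h : S y ∈ T.domain, T ⟨S y, h⟩ = y) : IsInverseOf S T := by
  refine ⟨fun x => ?_, hS⟩
  obtain ⟨h, e⟩ := hS (T x)
  have := hT (⟨S (T x), h⟩ - x) (by rw [LinearPMap.map_sub, e, sub_self])
  exact sub_eq_zero.1 this

theorem isInverseOf_boundedInverse {F : Type*} [NormedAddCommGroup F] [InnerProductSpace 𝕜 F]
    {T : E →ₗ.[𝕜] F} (hT : BoundedlyInvertible T) : IsInverseOf (boundedInverse T) T := by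
  obtain ⟨S, hS⟩ := hT
  rwa [boundedInverse_eq hS]

theorem pencil_apply (M : E →L[𝕜] E) (A : E →ₗ.[𝕜] E) (ε : ℝ) (x : A.domain) :
    pencil M A ε x = M x + ((ε⁻¹ : ℝ) : 𝕜) • A x := rfl

theorem cornerOp_apply (M : E →L[𝕜] E) (N : Submodule 𝕜 E) [N.HasOrthogonalProjection] (x : E) :
    cornerOp M N x = N.starProjection (M (N.starProjection x)) := rfl

theorem norm_le_of_coercive {c : ℝ} (hc : 0 < c) {x y : E}
    (h : c * ‖x‖ ^ 2 ≤ RCLike.re (inner 𝕜 y x)) : ‖x‖ ≤ c⁻¹ * ‖y‖ := by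
  rw [inv_mul_eq_div, le_div_iff₀' hc]
  rcases eq_or_ne ‖x‖ 0 with h0 | h0
  · simp [h0]
  · have h1 := h.trans (re_inner_le_norm y x)
    have h2 : 0 < ‖x‖ := lt_of_le_of_ne (norm_nonneg _) h0.symm
    exact le_of_mul_le_mul_right (by nlinarith) h2

theorem re_inner_rePart [CompleteSpace E] (M : E →L[𝕜] E) (x : E) :
    RCLike.re (inner 𝕜 (rePart M x) x) = RCLike.re (inner 𝕜 (M x) x) := by
  have h2 : (2⁻¹ : 𝕜) = ((2⁻¹ : ℝ) : 𝕜) := by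
    rw [RCLike.ofReal_inv, RCLike.ofReal_ofNat]
  rw [rePart, _root_.smul_apply, _root_.add_apply, h2, inner_smul_left,
    RCLike.conj_ofReal, RCLike.re_ofReal_mul, inner_add_left,
    ContinuousLinearMap.adjoint_inner_left, map_add, ← inner_conj_symm x (M x), RCLike.conj_re]
  ring

theorem le_re_inner_of_le_rePart [CompleteSpace E] {M : E →L[𝕜] E} {c : ℝ}
    (h : (c : 𝕜) • ContinuousLinearMap.id 𝕜 E ≤ rePart M) (x : E) :
    c * ‖x‖ ^ 2 ≤ RCLike.re (inner 𝕜 (M x) x) := by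
  have := ((ContinuousLinearMap.le_def _ _).1 h).re_inner_nonneg_left x
  rw [_root_.sub_apply, inner_sub_left, map_sub, re_inner_rePart,
    _root_.smul_apply, ContinuousLinearMap.id_apply, inner_smul_left,
    RCLike.conj_ofReal, RCLike.re_ofReal_mul, inner_self_eq_norm_sq] at this
  linarith

section SkewSelfAdjoint

variable [CompleteSpace E] {A : E →ₗ.[𝕜] E}

theorem IsSkewSelfAdjoint.inner_apply (hA : IsSkewSelfAdjoint A) (x y : A.domain) :
    inner 𝕜 (A x) (y : E) = -inner 𝕜 (x : E) (A y) := by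
  obtain ⟨x, hx⟩ := x
  obtain ⟨hx', e1, e2⟩ := (LinearPMap.mem_graph_iff _).1
    (LinearPMap.le_graph_iff.2 hA.2.le (A.mem_graph ⟨x, hx⟩))
  dsimp only at e1 e2
  have h1 := LinearPMap.adjoint_isFormalAdjoint hA.1 hx' y
  rw [← e2, LinearPMap.neg_apply, inner_neg_left, h1, e1]

theorem IsSkewSelfAdjoint.re_inner_apply_self (hA : IsSkewSelfAdjoint A) (x : A.domain) :
    RCLike.re (inner 𝕜 (A x) (x : E)) = 0 := by
  have h := congrArg RCLike.re (hA.inner_apply x x)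
  rw [map_neg, ← inner_conj_symm (x : E) (A x), RCLike.conj_re] at h
  linarith

/-- This is where skew-selfadjointness exceeds skew-symmetry: a weak solution lies in `dom A* = dom
A`. -/
theorem IsSkewSelfAdjoint.mem_domain (hA : IsSkewSelfAdjoint A) {y w : E}
    (h : ∀ x : A.domain, inner 𝕜 w (x : E) = inner 𝕜 y (A x)) : y ∈ A.domain := by
  rw [hA.2]
  exact LinearPMap.mem_adjoint_domain_of_exists y ⟨w, h⟩

theorem IsSkewSelfAdjoint.isClosed_graph (hA : IsSkewSelfAdjoint A) :
    IsClosed (A.graph : Set (E × E)) := by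
  have h : (A.graph : Set (E × E)) =
      (fun p : E × E => (p.1, -p.2)) ⁻¹' (A.adjoint.graph : Set (E × E)) := by
    ext ⟨x, y⟩
    conv_lhs => rw [hA.2]
    simp only [SetLike.mem_coe, Set.mem_preimage, LinearPMap.mem_graph_iff, LinearPMap.neg_apply]
    exact exists_congr fun z => and_congr_right fun _ => neg_eq_iff_eq_neg
  rw [h]
  exact (LinearPMap.adjoint_isClosed hA.1).preimage (by fun_prop)

theorem le_re_inner_pencil (hA : IsSkewSelfAdjoint A) {M : E →L[𝕜] E} {c : ℝ} (ε : ℝ) (x : A.domain)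
    (hM : c * ‖(x : E)‖ ^ 2 ≤ RCLike.re (inner 𝕜 (M x) (x : E))) :
    c * ‖(x : E)‖ ^ 2 ≤ RCLike.re (inner 𝕜 (M x + ((ε⁻¹ : ℝ) : 𝕜) • A x) (x : E)) := by
  rw [inner_add_left, map_add, inner_smul_left, RCLike.conj_ofReal, RCLike.re_ofReal_mul,
    hA.re_inner_apply_self, mul_zero, add_zero]
  exact hM

/-- A coercive bounded perturbation of a skew-selfadjoint operator is boundedly invertible. -/
theorem boundedlyInvertible_pencil (hA : IsSkewSelfAdjoint A) {M : E →L[𝕜] E} {c : ℝ} (hc : 0 < c)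
    (hM : ∀ x, c * ‖x‖ ^ 2 ≤ RCLike.re (inner 𝕜 (M x) x)) {ε : ℝ} (hε : 0 < ε) :
    BoundedlyInvertible (pencil M A ε) := by
  have : CompleteSpace A.graph := hA.isClosed_graph.completeSpace_coe
  -- On the closed graph of `A`, a complete space, the pencil becomes an everywhere defined bounded
  -- operator; it remains to show that it is bounded below with dense range.
  let L : A.graph →L[𝕜] E := (M ∘L ContinuousLinearMap.fst 𝕜 E E +
    ((ε⁻¹ : ℝ) : 𝕜) • ContinuousLinearMap.snd 𝕜 E E) ∘L A.graph.subtypeL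
  have hL (p : A.graph) : L p = M p.1.1 + ((ε⁻¹ : ℝ) : 𝕜) • p.1.2 := rfl
  have hLA (x : A.domain) : L ⟨_, A.mem_graph x⟩ = M x + ((ε⁻¹ : ℝ) : 𝕜) • A x := rfl
  have hco (p : A.graph) : ‖p.1.1‖ ≤ c⁻¹ * ‖L p‖ := by
    obtain ⟨x, hx1, hx2⟩ := (LinearPMap.mem_graph_iff _).1 p.2
    apply norm_le_of_coercive (𝕜 := 𝕜) hc
    rw [hL, ← hx1, ← hx2]
    exact le_re_inner_pencil hA ε x (hM x)
  have hco2 (p : A.graph) : ‖p.1.2‖ ≤ ε * (1 + ‖M‖ * c⁻¹) * ‖L p‖ := by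
    have h1 : ‖((ε⁻¹ : ℝ) : 𝕜) • p.1.2‖ = ‖L p - M p.1.1‖ := by rw [hL, add_sub_cancel_left]
    rw [norm_smul, RCLike.norm_ofReal, abs_of_pos (inv_pos.2 hε), inv_mul_eq_iff_eq_mul₀ hε.ne']
      at h1
    rw [h1, mul_assoc]
    gcongr
    calc ‖L p - M p.1.1‖ ≤ ‖L p‖ + ‖M p.1.1‖ := norm_sub_le _ _
      _ ≤ ‖L p‖ + ‖M‖ * (c⁻¹ * ‖L p‖) := by
        gcongr
        exact (M.le_opNorm _).trans (by gcongr; exact hco p)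
      _ = _ := by ring
  have hanti : AntilipschitzWith (max c⁻¹ (ε * (1 + ‖M‖ * c⁻¹))).toNNReal L := by
    refine AddMonoidHomClass.antilipschitz_of_bound L fun p => ?_
    rw [Real.coe_toNNReal _ (le_max_of_le_left (inv_pos.2 hc).le), Submodule.coe_norm,
      Prod.norm_def]
    refine max_le ((hco p).trans ?_) ((hco2 p).trans ?_) <;> gcongr
    · exact le_max_left _ _
    · exact le_max_right _ _
  have hclosed : IsClosed (L.range : Set E) := by
    rw [LinearMap.coe_range]
    exact hanti.isClosed_range L.uniformContinuous
  have hker : L.ker = ⊥ := LinearMap.ker_eq_bot.2 hanti.injective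
  have hrange : L.range = ⊤ := by
    have : CompleteSpace L.range := hclosed.completeSpace_coe
    rw [← Submodule.orthogonal_eq_bot_iff, eq_bot_iff]
    intro y hy
    have hy' (x : A.domain) : inner 𝕜 y (M x + ((ε⁻¹ : ℝ) : 𝕜) • A x) = 0 :=
      Submodule.inner_left_of_mem_orthogonal (LinearMap.mem_range_self _ _) hy |>
        fun h => (hLA x) ▸ h
    have hdom : y ∈ A.domain := by
      -- Orthogonality of `y` to the range gives `⟪y, A x⟫ = -ε ⟪y, M x⟫ = ⟪-ε M* y, x⟫`.
      apply hA.mem_domain (w := -((ε : ℝ) : 𝕜) • ContinuousLinearMap.adjoint M y)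
      intro x
      have h := hy' x
      rw [inner_add_right, inner_smul_right, RCLike.ofReal_inv] at h
      have hε0 : (ε : 𝕜) ≠ 0 := by simpa using hε.ne'
      rw [inner_smul_left, map_neg, RCLike.conj_ofReal, ContinuousLinearMap.adjoint_inner_left]
      field_simp at h
      linear_combination -h
    -- Now `y` is itself an admissible test vector, and coercivity forces `y = 0`.
    have h := le_re_inner_pencil hA ε ⟨y, hdom⟩ (hM y)
    rw [← inner_conj_symm, hy' ⟨y, hdom⟩, map_zero, map_zero] at h
    have : ‖y‖ ^ 2 ≤ 0 := by
      by_contra hlt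
      exact absurd h (not_le.2 (mul_pos hc (not_le.1 hlt)))
    simpa using this
  let e := ContinuousLinearEquiv.ofBijective L hker hrange
  refine ⟨ContinuousLinearMap.fst 𝕜 E E ∘L A.graph.subtypeL ∘L (e.symm : E →L[𝕜] A.graph),
    fun x => ?_, fun y => ?_⟩
  · have h : e.symm (L ⟨_, A.mem_graph x⟩) = ⟨_, A.mem_graph x⟩ := e.symm_apply_apply _
    exact congrArg (fun p : A.graph => p.1.1) h
  · obtain ⟨x, hx1, hx2⟩ := (LinearPMap.mem_graph_iff _).1 (e.symm y).2
    have h : L (e.symm y) = y := e.apply_symm_apply y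
    have hx : ((e.symm y).1.1) ∈ A.domain := hx1 ▸ x.2
    refine ⟨hx, ?_⟩
    have hxe : x = ⟨_, hx⟩ := Subtype.ext hx1
    rw [hL, ← hx2, hxe] at h
    exact h

end SkewSelfAdjoint

end Fibre


/-! ### Splitting along `N` and `Nᗮ`, and the fibrewise estimate -/

section Reduction

variable {𝕜 : Type*} [RCLike 𝕜] {E : Type*} [NormedAddCommGroup E] [InnerProductSpace 𝕜 E]
  {A : E →ₗ.[𝕜] E} {N : Submodule 𝕜 E} [CompleteSpace N]

theorem apply_starProjection_orthogonal
    (hred : (Nᗮ.starProjection : E →ₗ[𝕜] E).compPMap A ≤ compCLM A Nᗮ.starProjection)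
    (x : A.domain) :
    ∃ h : Nᗮ.starProjection (x : E) ∈ A.domain, A ⟨_, h⟩ = Nᗮ.starProjection (A x) :=
  ⟨hred.1 x.2, (hred.2 (x := x) (y := ⟨x, hred.1 x.2⟩) rfl).symm⟩

theorem apply_starProjection
    (hred : (Nᗮ.starProjection : E →ₗ[𝕜] E).compPMap A ≤ compCLM A Nᗮ.starProjection)
    (x : A.domain) :
    ∃ h : N.starProjection (x : E) ∈ A.domain, A ⟨_, h⟩ = N.starProjection (A x) := by
  obtain ⟨h, e⟩ := apply_starProjection_orthogonal hred x
  have hP (y : E) : N.starProjection y = y - Nᗮ.starProjection y := by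
    rw [Submodule.starProjection_orthogonal_val, sub_sub_cancel]
  have hx : N.starProjection (x : E) ∈ A.domain := by
    rw [hP]
    exact A.domain.sub_mem x.2 h
  refine ⟨hx, ?_⟩
  have : (⟨_, hx⟩ : A.domain) = x - ⟨_, h⟩ := Subtype.ext (hP x)
  rw [this, LinearPMap.map_sub, e, hP]

theorem le_re_inner_cornerOp {M : E →L[𝕜] E} {c : ℝ}
    (hM : ∀ x, c * ‖x‖ ^ 2 ≤ RCLike.re (inner 𝕜 (M x) x)) (x : E) :
    c * ‖N.starProjection x‖ ^ 2 ≤ RCLike.re (inner 𝕜 (cornerOp M N x) x) := by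
  rw [cornerOp_apply, Submodule.inner_starProjection_left_eq_right]
  exact hM _

theorem eq_zero_of_coercive {c : ℝ} (hc : 0 < c) {x : E}
    (h : c * ‖x‖ ^ 2 ≤ RCLike.re (inner 𝕜 (0 : E) x)) : x = 0 := by
  simpa using norm_le_of_coercive (𝕜 := 𝕜) hc h

variable [CompleteSpace E]

theorem coe_adjoint_subtypeL (K : Submodule 𝕜 E) [CompleteSpace K] (y : E) :
    (ContinuousLinearMap.adjoint K.subtypeL y : E) = K.starProjection y := by
  rw [Submodule.adjoint_subtypeL, Submodule.starProjection_apply]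

theorem coe_compression (K : Submodule 𝕜 E) [CompleteSpace K] (x : (compression A K).domain) :
    (compression A K x : E) = K.starProjection (A ⟨(x : K), x.2⟩) :=
  coe_adjoint_subtypeL K _

theorem norm_le_mul_norm_apply {K : Submodule 𝕜 E} [CompleteSpace K] {G : K →L[𝕜] K}
    (hG : IsInverseOf G (compression A K)) (x : A.domain) (hx : (x : E) ∈ K) :
    ‖(x : E)‖ ≤ ‖G‖ * ‖A x‖ := by
  have h := G.le_opNorm (compression A K ⟨⟨x, hx⟩, x.2⟩)
  rw [hG.1, Submodule.coe_norm, Submodule.coe_norm, coe_compression] at h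
  refine h.trans ?_
  gcongr
  exact Submodule.norm_starProjection_apply_le _ _

/-- The corner pencil is block diagonal: coercive on `N`, equal to `ε⁻¹ A` on `Nᗮ`. The inverse is
glued from the inverses of the two blocks. -/
theorem boundedlyInvertible_pencil_cornerOp (hA : IsSkewSelfAdjoint A)
    {M : E →L[𝕜] E} {c : ℝ} (hc : 0 < c) (hM : ∀ x, c * ‖x‖ ^ 2 ≤ RCLike.re (inner 𝕜 (M x) x))
    (hred : (Nᗮ.starProjection : E →ₗ[𝕜] E).compPMap A ≤ compCLM A Nᗮ.starProjection)
    (hinv : BoundedlyInvertible (compression A Nᗮ)) {ε : ℝ} (hε : 0 < ε) :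
    BoundedlyInvertible (pencil (cornerOp M N) A ε) := by
  obtain ⟨G, hG⟩ := hinv
  have hε0 : (ε : 𝕜) ≠ 0 := by simpa using hε.ne'
  have hQP (y : E) : Nᗮ.starProjection (N.starProjection y) = 0 :=
    Submodule.starProjection_orthogonal_apply_eq_zero (Submodule.starProjection_apply_mem _ _)
  have hPQ {y : E} (hy : y ∈ Nᗮ) : N.starProjection y = 0 :=
    Submodule.starProjection_apply_eq_zero_iff _ |>.2 hy
  have hsum (y : E) : N.starProjection y + Nᗮ.starProjection y = y :=
    Submodule.starProjection_add_starProjection_orthogonal y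
  -- Adding `c Q` restores coercivity on all of `E` without changing the block on `N`.
  let M' : E →L[𝕜] E := cornerOp M N + (c : 𝕜) • Nᗮ.starProjection
  have hM'_apply (x : E) : M' x = cornerOp M N x + (c : 𝕜) • Nᗮ.starProjection x := rfl
  have hM' (x : E) : c * ‖x‖ ^ 2 ≤ RCLike.re (inner 𝕜 (M' x) x) := by
    have h1 := le_re_inner_cornerOp (N := N) hM x
    rw [hM'_apply, inner_add_left, map_add, inner_smul_left, RCLike.conj_ofReal,
      RCLike.re_ofReal_mul, Submodule.re_inner_starProjection_eq_normSq,
      Submodule.norm_sq_eq_add_norm_sq_starProjection x N]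
    rw [mul_add]
    exact add_le_add h1 le_rfl
  obtain ⟨S, hS⟩ := boundedlyInvertible_pencil hA hc hM' hε
  refine ⟨S ∘L N.starProjection +
    (ε : 𝕜) • (Nᗮ.subtypeL ∘L G ∘L ContinuousLinearMap.adjoint Nᗮ.subtypeL),
    IsInverseOf.of_injective (fun x hx => ?_) fun y => ?_⟩
  · change A.domain at x
    rw [pencil_apply] at hx
    obtain ⟨hQx, eQ⟩ := apply_starProjection_orthogonal hred x
    have h1 := congrArg Nᗮ.starProjection hx
    rw [map_add, cornerOp_apply, hQP, zero_add, map_smul, map_zero, smul_eq_zero, ← eQ] at h1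
    have h2 := h1.resolve_left (by simpa using hε.ne')
    have h3 := norm_le_mul_norm_apply hG ⟨_, hQx⟩ (Submodule.starProjection_apply_mem _ _)
    rw [h2, norm_zero, mul_zero, norm_le_zero_iff] at h3
    dsimp only at h3
    have h4 : N.starProjection (x : E) = x := by
      conv_rhs => rw [← hsum x, h3, add_zero]
    have h5 := le_re_inner_pencil hA ε x (M := cornerOp M N) (c := c) (by
      conv_lhs => rw [← h4]
      exact le_re_inner_cornerOp hM _)
    rw [hx] at h5
    exact eq_zero_of_coercive (𝕜 := 𝕜) hc h5
  · obtain ⟨hz, ez⟩ := hS.2 (N.starProjection y)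
    set z := S (N.starProjection y)
    change z ∈ A.domain at hz
    have ez' : M' z + ((ε⁻¹ : ℝ) : 𝕜) • A ⟨z, hz⟩ = N.starProjection y := ez
    obtain ⟨hQz, eQ⟩ := apply_starProjection_orthogonal hred ⟨z, hz⟩
    dsimp only at hQz eQ
    -- The right-hand side lies in `N`, so `Q z` solves the homogeneous equation `(c + ε⁻¹ A) Q z =
    -- 0`.
    have hQz0 : Nᗮ.starProjection z = 0 := by
      have h1 := congrArg Nᗮ.starProjection ez'
      rw [hM'_apply, map_add, map_add, cornerOp_apply, hQP, hQP, zero_add, map_smul, map_smul,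
        ← eQ, Submodule.starProjection_eq_self_iff.2 (Submodule.starProjection_apply_mem _ _)] at h1
      have h2 := le_re_inner_pencil hA ε ⟨_, hQz⟩ (M := (c : 𝕜) • ContinuousLinearMap.id 𝕜 E)
        (c := c) (by
          rw [_root_.smul_apply, ContinuousLinearMap.id_apply, inner_smul_left,
            RCLike.conj_ofReal, RCLike.re_ofReal_mul, inner_self_eq_norm_sq])
      rw [_root_.smul_apply, ContinuousLinearMap.id_apply, h1] at h2
      exact eq_zero_of_coercive (𝕜 := 𝕜) hc h2
    rw [hM'_apply, hQz0, smul_zero, add_zero] at ez'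
    obtain ⟨hr, er⟩ := hG.2 (ContinuousLinearMap.adjoint Nᗮ.subtypeL y)
    set r := G (ContinuousLinearMap.adjoint Nᗮ.subtypeL y)
    have hr' : (r : E) ∈ A.domain := hr
    have er' : A ⟨r, hr'⟩ = Nᗮ.starProjection y := by
      have h1 := congrArg (Subtype.val : Nᗮ → E) er
      rw [coe_compression, coe_adjoint_subtypeL] at h1
      obtain ⟨h2, e2⟩ := apply_starProjection_orthogonal hred ⟨r, hr'⟩
      rw [← h1, ← e2]
      congr 2
      exact (Submodule.starProjection_eq_self_iff.2 r.2).symm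
    have hmem : z + (ε : 𝕜) • (r : E) ∈ A.domain :=
      A.domain.add_mem hz (A.domain.smul_mem _ hr')
    refine ⟨hmem, ?_⟩
    have hAadd : A ⟨_, hmem⟩ = A ⟨z, hz⟩ + (ε : 𝕜) • A ⟨r, hr'⟩ := by
      rw [← LinearPMap.map_smul, ← LinearPMap.map_add]
      rfl
    change cornerOp M N (z + (ε : 𝕜) • (r : E)) + ((ε⁻¹ : ℝ) : 𝕜) • A ⟨_, hmem⟩ = y
    have hcr : cornerOp M N (r : E) = 0 := by
      rw [cornerOp_apply, hPQ r.2, map_zero, map_zero]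
    rw [hAadd, map_add, map_smul, hcr, smul_zero, add_zero, smul_add, ← add_assoc, ez', smul_smul,
      RCLike.ofReal_inv, inv_mul_cancel₀ hε0, one_smul, er', hsum]

theorem norm_boundedInverse_pencil_apply_le (hA : IsSkewSelfAdjoint A) {M : E →L[𝕜] E} {c : ℝ}
    (hc : 0 < c) (hM : ∀ x, c * ‖x‖ ^ 2 ≤ RCLike.re (inner 𝕜 (M x) x)) {ε : ℝ} (hε : 0 < ε)
    (y : E) : ‖boundedInverse (pencil M A ε) y‖ ≤ c⁻¹ * ‖y‖ := by
  obtain ⟨hu, eu⟩ := (isInverseOf_boundedInverse (boundedlyInvertible_pencil hA hc hM hε)).2 y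
  set u := boundedInverse (pencil M A ε) y
  change u ∈ A.domain at hu
  replace eu : M u + ((ε⁻¹ : ℝ) : 𝕜) • A ⟨u, hu⟩ = y := eu
  have h := le_re_inner_pencil hA ε ⟨u, hu⟩ (hM u)
  rw [eu] at h
  exact norm_le_of_coercive (𝕜 := 𝕜) hc h

/-- In the constant, `(1 + m c⁻¹) g` bounds `Q u`, the factor `1 + c⁻¹ m` adds the error in `N` that
it causes, and the last `g` bounds `Q v`. -/
theorem norm_boundedInverse_pencil_sub_le (hA : IsSkewSelfAdjoint A)
    {M : E →L[𝕜] E} {c : ℝ} (hc : 0 < c) (hM : ∀ x, c * ‖x‖ ^ 2 ≤ RCLike.re (inner 𝕜 (M x) x))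
    (hred : (Nᗮ.starProjection : E →ₗ[𝕜] E).compPMap A ≤ compCLM A Nᗮ.starProjection)
    (hinv : BoundedlyInvertible (compression A Nᗮ)) {m g : ℝ} (hm : ‖M‖ ≤ m)
    (hg : ‖boundedInverse (compression A Nᗮ)‖ ≤ g) {ε : ℝ} (hε : 0 < ε) :
    ‖boundedInverse (pencil M A ε) - boundedInverse (pencil (cornerOp M N) A ε)‖ ≤
      ((1 + c⁻¹ * m) * (1 + m * c⁻¹) + 1) * g * ε := by
  have hm0 : 0 ≤ m := (norm_nonneg _).trans hm
  have hg0 : 0 ≤ g := (norm_nonneg _).trans hg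
  refine ContinuousLinearMap.opNorm_le_bound _ (by positivity) fun y => ?_
  have hu_norm := norm_boundedInverse_pencil_apply_le hA hc hM hε y
  obtain ⟨hu, eu⟩ := (isInverseOf_boundedInverse (boundedlyInvertible_pencil hA hc hM hε)).2 y
  obtain ⟨hv, ev⟩ := (isInverseOf_boundedInverse
    (boundedlyInvertible_pencil_cornerOp hA hc hM hred hinv hε)).2 y
  rw [_root_.sub_apply]
  set u := boundedInverse (pencil M A ε) y
  set v := boundedInverse (pencil (cornerOp M N) A ε) y
  change u ∈ A.domain at hu
  change v ∈ A.domain at hv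
  replace eu : M u + ((ε⁻¹ : ℝ) : 𝕜) • A ⟨u, hu⟩ = y := eu
  replace ev : cornerOp M N v + ((ε⁻¹ : ℝ) : 𝕜) • A ⟨v, hv⟩ = y := ev
  have hG := isInverseOf_boundedInverse hinv
  have hsum (x : E) : N.starProjection x + Nᗮ.starProjection x = x :=
    Submodule.starProjection_add_starProjection_orthogonal x
  have hQP (x : E) : Nᗮ.starProjection (N.starProjection x) = 0 :=
    Submodule.starProjection_orthogonal_apply_eq_zero (Submodule.starProjection_apply_mem _ _)
  have hPP (x : E) : N.starProjection (N.starProjection x) = N.starProjection x :=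
    Submodule.starProjection_eq_self_iff.2 (Submodule.starProjection_apply_mem _ _)
  -- the component of a solution in `Nᗮ` is of order `ε`
  have hQ (x b : E) (hx : x ∈ A.domain)
      (h : Nᗮ.starProjection b = ((ε⁻¹ : ℝ) : 𝕜) • Nᗮ.starProjection (A ⟨x, hx⟩)) :
      ‖Nᗮ.starProjection x‖ ≤ g * (ε * ‖b‖) := by
    obtain ⟨hQx, eQ⟩ := apply_starProjection_orthogonal hred ⟨x, hx⟩
    have h1 := norm_le_mul_norm_apply hG ⟨_, hQx⟩ (Submodule.starProjection_apply_mem _ _)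
    have h2 := congrArg norm h
    rw [← eQ, norm_smul, RCLike.norm_ofReal, abs_of_pos (inv_pos.2 hε), eq_comm,
      inv_mul_eq_iff_eq_mul₀ hε.ne'] at h2
    refine h1.trans ?_
    rw [h2]
    gcongr
    exact Submodule.norm_starProjection_apply_le _ _
  have hMx (x : E) : ‖M x‖ ≤ m * ‖x‖ := M.le_of_opNorm_le hm x
  have hQu : ‖Nᗮ.starProjection u‖ ≤ g * (ε * ((1 + m * c⁻¹) * ‖y‖)) := by
    refine (hQ u (y - M u) hu ?_).trans ?_
    · rw [← map_smul, ← eu, add_sub_cancel_left]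
    · gcongr
      calc ‖y - M u‖ ≤ ‖y‖ + ‖M u‖ := norm_sub_le _ _
        _ ≤ ‖y‖ + m * (c⁻¹ * ‖y‖) := by
          gcongr
          exact (hMx u).trans (by gcongr)
        _ = _ := by ring
  have hQv : ‖Nᗮ.starProjection v‖ ≤ g * (ε * ‖y‖) := by
    refine hQ v y hv ?_
    rw [← ev, map_add, cornerOp_apply, hQP, zero_add, map_smul]
  obtain ⟨hPu, ePu⟩ := apply_starProjection hred ⟨u, hu⟩
  obtain ⟨hPv, ePv⟩ := apply_starProjection hred ⟨v, hv⟩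
  dsimp only at hPu ePu hPv ePv
  have hP : ‖N.starProjection u - N.starProjection v‖ ≤ c⁻¹ * (m * ‖Nᗮ.starProjection u‖) := by
    let w : A.domain := ⟨_, hPu⟩ - ⟨_, hPv⟩
    have hw : (w : E) = N.starProjection u - N.starProjection v := rfl
    have hPw : N.starProjection (w : E) = w := by rw [hw, map_sub, hPP, hPP]
    have h1 := le_re_inner_pencil hA ε w (M := cornerOp M N) (c := c) (by
      conv_lhs => rw [← hPw]
      exact le_re_inner_cornerOp hM _)
    -- Project both equations by `P`, subtract, and split `M u = M P u + M Q u`.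
    have h2 : cornerOp M N (w : E) + ((ε⁻¹ : ℝ) : 𝕜) • A w =
        -N.starProjection (M (Nᗮ.starProjection u)) := by
      have h3 := congrArg N.starProjection (eu.trans ev.symm)
      have h4 : M u = M (N.starProjection u) + M (Nᗮ.starProjection u) := by
        rw [← map_add, hsum]
      rw [map_add, map_add, map_smul, map_smul, ← ePu, ← ePv, cornerOp_apply, hPP, h4,
        map_add] at h3
      rw [cornerOp_apply, hPw, hw, map_sub, map_sub, LinearPMap.map_sub, smul_sub]
      rw [← sub_eq_zero] at h3 ⊢
      rw [← h3]
      abel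
    have h5 := norm_le_of_coercive (𝕜 := 𝕜) hc h1
    rw [h2, norm_neg] at h5
    refine h5.trans ?_
    gcongr
    exact (Submodule.norm_starProjection_apply_le _ _).trans (hMx _)
  have hdecomp : u - v = (N.starProjection u - N.starProjection v) +
      (Nᗮ.starProjection u - Nᗮ.starProjection v) := by
    conv_lhs => rw [← hsum u, ← hsum v]
    abel
  calc ‖u - v‖ ≤ ‖N.starProjection u - N.starProjection v‖ +
        (‖Nᗮ.starProjection u‖ + ‖Nᗮ.starProjection v‖) := by
        rw [hdecomp]
        exact (norm_add_le _ _).trans (by gcongr; exact norm_sub_le _ _)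
    _ ≤ (1 + c⁻¹ * m) * ‖Nᗮ.starProjection u‖ + ‖Nᗮ.starProjection v‖ := by linarith
    _ ≤ (1 + c⁻¹ * m) * (g * (ε * ((1 + m * c⁻¹) * ‖y‖))) + g * (ε * ‖y‖) := by gcongr
    _ = _ := by ring

end Reduction

theorem norm_extendByZero_le {𝕜 : Type*} [RCLike 𝕜] {H : Type*} [NormedAddCommGroup H]
    [InnerProductSpace 𝕜 H] [CompleteSpace H] (K : Submodule 𝕜 H) [CompleteSpace K]
    (T : K →L[𝕜] K) : ‖extendByZero K T‖ ≤ ‖T‖ := by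
  refine ContinuousLinearMap.opNorm_le_bound _ (norm_nonneg _) fun x => ?_
  change ‖T (ContinuousLinearMap.adjoint K.subtypeL x)‖ ≤ _
  refine (T.le_opNorm _).trans ?_
  gcongr
  rw [Submodule.coe_norm, coe_adjoint_subtypeL]
  exact Submodule.norm_starProjection_apply_le _ _

theorem extendByZero_sub {𝕜 : Type*} [RCLike 𝕜] {H : Type*} [NormedAddCommGroup H]
    [InnerProductSpace 𝕜 H] [CompleteSpace H] (K : Submodule 𝕜 H) [CompleteSpace K]
    (S T : K →L[𝕜] K) : extendByZero K (S - T) = extendByZero K S - extendByZero K T := by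
  ext x
  simp [extendByZero]


/-! ### Direct integrals of weakly measurable families -/

section DirectIntegral

variable {𝕜 : Type*} [RCLike 𝕜] {H : Type*} [NormedAddCommGroup H] [InnerProductSpace 𝕜 H]
  {X : Type*} [MeasurableSpace X] {μ : Measure X}

/-- Balls of radius `1 / 2` about orthonormal vectors are disjoint open sets. -/
theorem countable_of_orthonormal [TopologicalSpace.SeparableSpace H] {ι : Type*} {v : ι → H}
    (hv : Orthonormal 𝕜 v) : Countable ι := by
  have hdist {i j : ι} (hij : i ≠ j) : 1 ≤ dist (v i) (v j) := by
    have h := norm_sub_sq (𝕜 := 𝕜) (v i) (v j)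
    rw [hv.2 hij, hv.1, hv.1, map_zero] at h
    rw [dist_eq_norm]
    nlinarith [norm_nonneg (v i - v j)]
  have hd : (Set.univ : Set ι).PairwiseDisjoint fun i => Metric.ball (v i) (1 / 2) :=
    fun i _ j _ hij => Metric.ball_disjoint_ball (by linarith [hdist hij])
  exact Set.countable_univ_iff.1 <| hd.countable_of_isOpen (fun _ _ => Metric.isOpen_ball)
    fun i _ => ⟨v i, Metric.mem_ball_self (by norm_num)⟩

/-- Two expansions in a countable Hilbert basis: of `T θ y` for constant `y`, which needs only
matrix coefficients, then of `f θ`, with `T θ` taken through the sum by continuity. -/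
theorem WeaklyMeasurable.aestronglyMeasurable_apply [CompleteSpace H]
    [TopologicalSpace.SeparableSpace H] {T : X → H →L[𝕜] H} (hT : WeaklyMeasurable μ T) {f : X → H}
    (hf : AEStronglyMeasurable f μ) : AEStronglyMeasurable (fun θ => T θ (f θ)) μ := by
  obtain ⟨w, b, -⟩ := exists_hilbertBasis 𝕜 H
  have : Countable w := countable_of_orthonormal b.orthonormal
  have hconst (y : H) : AEStronglyMeasurable (fun θ => T θ y) μ := by
    refine aestronglyMeasurable_of_tendsto_ae Filter.atTop
      (f := fun (s : Finset w) θ => ∑ i ∈ s, b.repr (T θ y) i • b i) (fun s => ?_)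
      (Filter.Eventually.of_forall fun θ => b.hasSum_repr (T θ y))
    refine Finset.aestronglyMeasurable_fun_sum s fun i _ => AEStronglyMeasurable.smul_const ?_ _
    simp only [b.repr_apply_apply]
    exact (hT (b i) y).aestronglyMeasurable
  refine aestronglyMeasurable_of_tendsto_ae Filter.atTop
    (f := fun (s : Finset w) θ => ∑ i ∈ s, b.repr (f θ) i • T θ (b i)) (fun s => ?_)
    (Filter.Eventually.of_forall fun θ => ?_)
  · refine Finset.aestronglyMeasurable_fun_sum s fun i _ => AEStronglyMeasurable.smul ?_ (hconst _)
    simp only [b.repr_apply_apply]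
    exact hf.const_inner
  · have := (T θ).hasSum (b.hasSum_repr (f θ))
    simp only [map_smul] at this
    exact this

/-- A weakly measurable, uniformly bounded family of operators on a separable Hilbert space has a
direct integral. -/
theorem WeaklyMeasurable.exists_isDirectIntegral [CompleteSpace H]
    [TopologicalSpace.SeparableSpace H] {T : X → H →L[𝕜] H} (hT : WeaklyMeasurable μ T) {K : ℝ}
    (hK : ∀ θ, ‖T θ‖ ≤ K) : ∃ C, IsDirectIntegral μ T C := by
  have hle (f : X → H) (θ : X) : ‖T θ (f θ)‖ ≤ K * ‖f θ‖ := (T θ).le_of_opNorm_le (hK θ) _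
  have hmem (f : Lp H 2 μ) : MemLp (fun θ => T θ (f θ)) 2 μ :=
    (Lp.memLp f).of_le_mul (hT.aestronglyMeasurable_apply (Lp.aestronglyMeasurable f))
      (Filter.Eventually.of_forall (hle f))
  let L : Lp H 2 μ →ₗ[𝕜] Lp H 2 μ :=
    { toFun := fun f => (hmem f).toLp
      map_add' := fun f g => by
        rw [← MemLp.toLp_add]
        refine MemLp.toLp_congr _ _ ?_
        filter_upwards [Lp.coeFn_add f g] with θ h
        rw [h, Pi.add_apply, Pi.add_apply, map_add]
      map_smul' := fun a f => by
        rw [RingHom.id_apply, ← MemLp.toLp_const_smul]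
        refine MemLp.toLp_congr _ _ ?_
        filter_upwards [Lp.coeFn_smul a f] with θ h
        rw [h, Pi.smul_apply, Pi.smul_apply, map_smul] }
  refine ⟨L.mkContinuous K fun f => Lp.norm_le_mul_norm_of_ae_le_mul ?_,
    fun f => (hmem f).coeFn_toLp⟩
  filter_upwards [(hmem f).coeFn_toLp] with θ h
  exact (congrArg norm h).trans_le (hle f θ)

theorem IsDirectIntegral.norm_sub_le {S T : X → H →L[𝕜] H} {C D : Lp H 2 μ →L[𝕜] Lp H 2 μ}
    (hC : IsDirectIntegral μ S C) (hD : IsDirectIntegral μ T D) {K : ℝ} (hK0 : 0 ≤ K)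
    (hK : ∀ θ, ‖S θ - T θ‖ ≤ K) : ‖C - D‖ ≤ K := by
  refine ContinuousLinearMap.opNorm_le_bound _ hK0 fun f => Lp.norm_le_mul_norm_of_ae_le_mul ?_
  filter_upwards [hC f, hD f, Lp.coeFn_sub (C f) (D f)] with θ h1 h2 h3
  rw [_root_.sub_apply, h3, Pi.sub_apply, h1, h2, ← _root_.sub_apply]
  exact (S θ - T θ).le_of_opNorm_le (hK θ) _

end DirectIntegral

end FibreHom

/-! ### Uniform constants and conclusion -/

theorem theorem2p11 {𝕜 : Type*} [RCLike 𝕜]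
    {H : Type*} [NormedAddCommGroup H] [InnerProductSpace 𝕜 H] [CompleteSpace H]
    {d : ℕ} (Θ : Set (EuclideanSpace ℝ (Fin d))) (hΘ : NullMeasurableSet Θ volume)
    -- the closed subspaces `H_θ ⊆ H` and `N(θ) ⊆ H_θ`
    (E : Θ → Submodule 𝕜 H) [∀ θ, CompleteSpace (E θ)]
    (N : ∀ θ, Submodule 𝕜 (E θ)) [∀ θ, CompleteSpace (N θ)]
    (M : ∀ θ, E θ →L[𝕜] E θ) (A : ∀ θ, E θ →ₗ.[𝕜] E θ)
    (hMbdd : BddAbove (Set.range fun θ => ‖M θ‖))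
    (hA : ∀ θ, FibreHom.IsSkewSelfAdjoint (A θ))
    (c : ℝ) (hc : 0 < c)
    (hM : ∀ θ, (c : 𝕜) • ContinuousLinearMap.id 𝕜 (E θ) ≤ FibreHom.rePart (M θ))
    (hAN : FibreHom.FibreHypothesis A N)
    (hmeas : ∀ ε : ℝ, 0 < ε →
      FibreHom.WeaklyMeasurable (FibreHom.lebesgueOn Θ) (FibreHom.fibreInverse E M A ε)) :
    ∃ κ : ℝ, 0 < κ ∧ ∀ ε : ℝ, 0 < ε →
      -- the inverses exist in each fibre
      (∀ θ, FibreHom.BoundedlyInvertible (FibreHom.pencil (M θ) (A θ) ε)) ∧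
      (∀ θ, FibreHom.BoundedlyInvertible
        (FibreHom.pencil (FibreHom.cornerOp (M θ) (N θ)) (A θ) ε)) ∧
      -- the direct integrals exist (the second one if its fibres depend measurably on `θ`)
      (TopologicalSpace.SeparableSpace H →
        ∃ C, FibreHom.IsDirectIntegral (FibreHom.lebesgueOn Θ)
          (FibreHom.fibreInverse E M A ε) C) ∧
      (TopologicalSpace.SeparableSpace H →
        FibreHom.WeaklyMeasurable (FibreHom.lebesgueOn Θ)
          (FibreHom.fibreInverse E (fun θ => FibreHom.cornerOp (M θ) (N θ)) A ε) →
        ∃ D, FibreHom.IsDirectIntegral (FibreHom.lebesgueOn Θ)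
          (FibreHom.fibreInverse E (fun θ => FibreHom.cornerOp (M θ) (N θ)) A ε) D) ∧
      -- and they are `κ ε`-close in operator norm
      ∀ C D : Lp H 2 (FibreHom.lebesgueOn Θ) →L[𝕜] Lp H 2 (FibreHom.lebesgueOn Θ),
        FibreHom.IsDirectIntegral (FibreHom.lebesgueOn Θ)
          (FibreHom.fibreInverse E M A ε) C →
        FibreHom.IsDirectIntegral (FibreHom.lebesgueOn Θ)
          (FibreHom.fibreInverse E (fun θ => FibreHom.cornerOp (M θ) (N θ)) A ε) D →
        ‖C - D‖ ≤ κ * ε := by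
  obtain ⟨m, hm⟩ := hMbdd
  obtain ⟨g, hg⟩ := hAN.uniform
  -- If `Θ` is empty, `m` and `g` may be negative; the maxima keep `κ` positive.
  have hm' (θ : Θ) : ‖M θ‖ ≤ max m 0 := (hm ⟨θ, rfl⟩).trans (le_max_left _ _)
  have hg' (θ : Θ) : ‖FibreHom.boundedInverse (FibreHom.compression (A θ) (N θ)ᗮ)‖ ≤ max g 1 :=
    (hg ⟨θ, rfl⟩).trans (le_max_left _ _)
  have hco (θ : Θ) := FibreHom.le_re_inner_of_le_rePart (hM θ)
  have hm0 : 0 ≤ max m 0 := le_max_right _ _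
  have hg0 : 0 < max g 1 := lt_max_of_lt_right one_pos
  obtain ⟨κ, hκ⟩ : ∃ κ, κ = ((1 + c⁻¹ * max m 0) * (1 + max m 0 * c⁻¹) + 1) * max g 1 := ⟨_, rfl⟩
  have hκ0 : 0 < κ := by
    rw [hκ]
    positivity
  refine ⟨κ, hκ0, fun ε hε => ?_⟩
  have hS (θ : Θ) : ‖FibreHom.fibreInverse E M A ε θ‖ ≤ c⁻¹ :=
    (FibreHom.norm_extendByZero_le _ _).trans <|
      ContinuousLinearMap.opNorm_le_bound _ (inv_pos.2 hc).le
        (FibreHom.norm_boundedInverse_pencil_apply_le (hA θ) hc (hco θ) hε)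
  have hST (θ : Θ) : ‖FibreHom.fibreInverse E M A ε θ -
      FibreHom.fibreInverse E (fun θ => FibreHom.cornerOp (M θ) (N θ)) A ε θ‖ ≤ κ * ε := by
    rw [FibreHom.fibreInverse, FibreHom.fibreInverse, ← FibreHom.extendByZero_sub, hκ]
    exact (FibreHom.norm_extendByZero_le _ _).trans
      (FibreHom.norm_boundedInverse_pencil_sub_le (hA θ) hc (hco θ) (hAN.reduces θ)
        (hAN.invertible θ) (hm' θ) (hg' θ) hε)
  refine ⟨fun θ => FibreHom.boundedlyInvertible_pencil (hA θ) hc (hco θ) hε,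
    fun θ => FibreHom.boundedlyInvertible_pencil_cornerOp (hA θ) hc (hco θ) (hAN.reduces θ)
      (hAN.invertible θ) hε,
    fun _ => (hmeas ε hε).exists_isDirectIntegral hS,
    -- The corner inverse is bounded uniformly in `θ` by the triangle inequality, through its
    -- distance `κ ε` from the full inverse.
    fun _ hT => hT.exists_isDirectIntegral (K := c⁻¹ + κ * ε) fun θ => ?_,
    fun C D hC hD => hC.norm_sub_le hD (mul_pos hκ0 hε).le hST⟩
  have := norm_sub_norm_le (FibreHom.fibreInverse E (fun θ => FibreHom.cornerOp (M θ) (N θ)) A ε θ)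
    (FibreHom.fibreInverse E M A ε θ)
  rw [norm_sub_rev] at this
  linarith [hS θ, hST θ]
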